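/- A finite field extension $K/k$ is called Hopf Galois if there are a finite-dimensional cocommutative $k$-Hopf algebra $H$, with comultiplication $\Delta(h)=\sum h_{(1)}\otimes h_{(2)}$ and counit $\varepsilon$, and a Hopf action $\mu\colon H\to\operatorname{End}_k(K)$, i.e. a $k$-algebra homomorphism with $\mu(h)(xy)=\sum \mu(h_{(1)})(x)\,\mu(h_{(2)})(y)$ and $\mu(h)(1)=\varepsilon(h)$ for all $h\in H$ and $x,y\in K$, such that the $k$-linear map $(1,\mu)\colon K\otimes_k H\to\operatorname{End}_k(K)$, $(1,\mu)(s\otimes h)(t)=s\cdot\mu(h)(t)$, is bijective. A subgroup $N$ of $S_n$ is regular if for all $i,j\in\{1,\dots,n\}$ there is a unique $\sigma\in N$ with $\sigma(i)=j$. For such $N$, the group $N\rtimes\operatorname{Aut}(N)$ acts faithfully on the set $N$ by $(a,\varphi)\cdot x=a\,\varphi(x)$; its holomorph $\operatorname{Hol}(N)\subseteq S_n$ is the group of permutations obtained from this action through the identification $N\to\{1,\dots,n\}$, $\sigma\mapsto\sigma(i)$, for a base point $i\in\{1,\dots,n\}$ (the subgroup $\operatorname{Hol}(N)$ does not depend on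 $i$). **Proposition.** Let $K/k$ be a finite separable field extension of degree $n$, let $\tilde K/k$ be its Galois closure, and let $G=\operatorname{Gal}(\tilde K/k)$. Assume that all transitive subgroups of $S_n$ isomorphic to $G$ are conjugate in $S_n$. Then $K/k$ is Hopf Galois if and only if there exists a regular subgroup $N$ of $S_n$ such that $\operatorname{Hol}(N)$ has a subgroup that is transitive on $\{1,\dots,n\}$ and isomorphic to $G$. -/

import Mathlib

open scoped TensorProduct

/-! ### Hopf Galois extensions -/

section HopfGalois

universe u v w

/-- A Hopf action of a `k`-Hopf algebra `H` on a `k`-algebra `K`: a homomorphism of `k`-algebras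
`μ : H → End_k(K)` (that is, an `H`-module structure on `K`) which makes `K` an `H`-module algebra:
`h · (x y) = ∑ (h₍₁₎ · x) (h₍₂₎ · y)`, where `Δ h = ∑ h₍₁₎ ⊗ h₍₂₎`, and `h · 1 = ε(h) 1`. -/
structure HopfAction (k : Type u) (H : Type w) (K : Type v) [Field k] [Field K] [Algebra k K]
    [Ring H] [HopfAlgebra k H] where
  /-- the `k`-algebra homomorphism `H → End_k(K)` -/
  μ : H →ₐ[k] Module.End k K
  map_mul : ∀ (h : H) (x y : K),
    μ h (x * y) = LinearMap.mul' k K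
      (TensorProduct.map (LinearMap.applyₗ x ∘ₗ μ.toLinearMap) (LinearMap.applyₗ y ∘ₗ μ.toLinearMap)
        (Coalgebra.comul (R := k) h))
  map_one : ∀ h : H, μ h 1 = algebraMap k K (Coalgebra.counit (R := k) h)

/-- The `k`-linear map `(1, μ) : K ⊗ H → End_k(K)` with `(1, μ)(s ⊗ h)(t) = s · μ(h)(t)`. -/
noncomputable def HopfAction.oneMu {k : Type u} {H : Type w} {K : Type v} [Field k] [Field K]
    [Algebra k K] [Ring H] [HopfAlgebra k H] (a : HopfAction k H K) :
    K ⊗[k] H →ₗ[k] Module.End k K :=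
  LinearMap.mul' k (Module.End k K) ∘ₗ
    TensorProduct.map (Algebra.lmul k K).toLinearMap a.μ.toLinearMap

theorem HopfAction.oneMu_tmul {k : Type u} {H : Type w} {K : Type v} [Field k] [Field K]
    [Algebra k K] [Ring H] [HopfAlgebra k H] (a : HopfAction k H K) (s : K) (h : H) (t : K) :
    a.oneMu (s ⊗ₜ[k] h) t = s * a.μ h t := rfl

/-- A finite field extension `K/k` is Hopf Galois if there are a finite-dimensional cocommutative
`k`-Hopf algebra `H` and a Hopf action `μ : H → End_k(K)` such that `(1, μ) : K ⊗ H → End_k(K)` is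
an isomorphism.  (The universe of `K` is no restriction on `H`: as a set, a finite-dimensional `H`
is in bijection with a power `k ^ d`, hence with a subset of `K ^ d`.) -/
def IsHopfGalois (k : Type u) (K : Type v) [Field k] [Field K] [Algebra k K] : Prop :=
  ∃ (H : Type v) (_ : Ring H) (_ : HopfAlgebra k H),
    Module.Finite k H ∧ Coalgebra.IsCocomm k H ∧
      ∃ a : HopfAction k H K, Function.Bijective a.oneMu

end HopfGalois

/-! ### Regular subgroups and holomorphs -/

section Holomorph

universe u

/-- A subgroup `N` of `Sym(S)` is regular if for all `i, j ∈ S` there is a unique `σ ∈ N`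
with `σ(i) = j`. -/
def IsRegularSubgroup {S : Type u} (N : Subgroup (Equiv.Perm S)) : Prop :=
  ∀ i j : S, ∃! σ : N, (σ : Equiv.Perm S) i = j

/-- The natural action of the abstract holomorph `N ⋊ Aut(N)` on `N`:
the pair `(a, φ)` acts by `x ↦ a * φ x`. -/
def holomorphHom (N : Type u) [Group N] :
    N ⋊[MonoidHom.id (MulAut N)] MulAut N →* Equiv.Perm N :=
  SemidirectProduct.lift (MulAction.toPermHom N N) (MulAut.toPerm N) (by
    intro φ
    ext a x
    change φ a * x = φ (a * φ.symm x)
    rw [map_mul, MulEquiv.apply_symm_apply])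

theorem holomorphHom_apply (N : Type u) [Group N] (p : N ⋊[MonoidHom.id (MulAut N)] MulAut N)
    (x : N) : holomorphHom N p x = p.left * p.right x := rfl

/-- The identification `N ≃ S`, `σ ↦ σ(i)`, of a regular subgroup `N` of `Sym(S)` with `S`, for a
base point `i`. -/
noncomputable def IsRegularSubgroup.equiv {S : Type u} {N : Subgroup (Equiv.Perm S)}
    (hN : IsRegularSubgroup N) (i : S) : N ≃ S :=
  Equiv.ofBijective (fun σ : N => (σ : Equiv.Perm S) i)
    ((Function.bijective_iff_existsUnique _).2 (hN i))

/-- The holomorph `Hol(N) = N ⋊ Aut(N)` of a regular subgroup `N` of `Sym(S)`, as a subgroup of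
`Sym(S)`: the image of `N ⋊ Aut(N)` in `Sym(N)`, carried over to `Sym(S)` by the identification
`N ≃ S`, `σ ↦ σ(i)`.  It does not depend on the base point `i`, see
`IsRegularSubgroup.hol_eq_hol`. -/
noncomputable def IsRegularSubgroup.hol {S : Type u} {N : Subgroup (Equiv.Perm S)}
    (hN : IsRegularSubgroup N) (i : S) : Subgroup (Equiv.Perm S) :=
  (holomorphHom N).range.map (hN.equiv i).permCongrHom.toMonoidHom

theorem IsRegularSubgroup.mem_hol {S : Type u} {N : Subgroup (Equiv.Perm S)}
    (hN : IsRegularSubgroup N) (i : S) (π : Equiv.Perm S) :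
    π ∈ hN.hol i ↔ ∃ (a : N) (φ : MulAut N), ∀ x : N,
      π ((x : Equiv.Perm S) i) = (a : Equiv.Perm S) ((φ x : Equiv.Perm S) i) := by
  have key : ∀ p : N ⋊[MonoidHom.id (MulAut N)] MulAut N,
      (hN.equiv i).permCongrHom (holomorphHom N p) = π ↔ ∀ x : N,
        π ((x : Equiv.Perm S) i) = (p.left : Equiv.Perm S) ((p.right x : Equiv.Perm S) i) := by
    intro p
    constructor
    · rintro rfl x
      change hN.equiv i (holomorphHom N p ((hN.equiv i).symm (hN.equiv i x))) = _
      rw [Equiv.symm_apply_apply]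
      rfl
    · intro h
      ext s
      obtain ⟨x, rfl⟩ := (hN.equiv i).surjective s
      change hN.equiv i (holomorphHom N p ((hN.equiv i).symm (hN.equiv i x))) = _
      rw [Equiv.symm_apply_apply]
      exact (h x).symm
  constructor
  · rintro ⟨_, ⟨p, rfl⟩, hp⟩
    exact ⟨p.left, p.right, (key p).1 hp⟩
  · rintro ⟨a, φ, h⟩
    exact ⟨_, ⟨⟨a, φ⟩, rfl⟩, (key ⟨a, φ⟩).2 h⟩

theorem IsRegularSubgroup.hol_eq_hol {S : Type u} {N : Subgroup (Equiv.Perm S)}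
    (hN : IsRegularSubgroup N) (i j : S) : hN.hol i = hN.hol j := by
  have main : ∀ i j : S, hN.hol i ≤ hN.hol j := by
    intro i j π hπ
    rw [IsRegularSubgroup.mem_hol] at hπ ⊢
    obtain ⟨a, φ, h⟩ := hπ
    obtain ⟨c, hc, -⟩ := hN i j
    obtain ⟨d, hd, -⟩ := hN j i
    refine ⟨a * (φ c * d), MulAut.conj (φ c * d)⁻¹ * φ, fun x => ?_⟩
    have h1 := h (x * c)
    rw [map_mul] at h1
    simp only [Subgroup.coe_mul, Equiv.Perm.mul_apply, hc] at h1
    rw [h1]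
    simp [hd]
  exact le_antisymm (main i j) (main j i)

end Holomorph

/-! Let `L` be the Galois closure and `X` the set of `k`-embeddings `K → L`. It has `n` elements,
and `G = Gal(L/k)` acts on it transitively and faithfully. The holomorph of a regular subgroup is
its normalizer, so the proposition reduces to the Greither–Pareigis criterion: `K/k` is Hopf Galois
iff `Sym(X)` has a regular subgroup `N` normalized by `G`. The conjugacy hypothesis lets a
transitive copy of `G` in `Hol(N)` be read as the image of `G` under a suitable labelling of `X`.

From `H` to `N`: since `(1, μ)` is bijective, for each embedding `ρ` the map `∑ cᵢ ⊗ bᵢ ↦ ∑ cᵢ ρ(bᵢ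
·)` is a bijection from `L ⊗ H` to `Hom_k(K, L)`. The element that sends `ρ` to another embedding
`τ` is group-like, because `τ` is multiplicative; hence it sends every embedding to an embedding
(`HopfAction.exists_twist_eq`). These elements form a group of permutations of `X`. It is regular by
bijectivity, and `G` normalizes it by acting on coefficients.

From `N` to `H`: take the invariants of `G` in `L[N]`, realized as the endomorphisms `T` of `K` with
`ρ ∘ T = ∑ c η • η(ρ)` for all `ρ` (`twistedAlgebra`). Galois descent gives a `k`-basis that is an
`L`-basis of the coefficient functions, so the group-algebra Hopf structure descends and its axioms
can be checked coefficientwise over `L`. Independence of embeddings makes `(1, μ)` injective, and a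
dimension count makes it bijective. -/

section RegularSubgroups

/-! ### Holomorphs as normalizers, and their transport along bijections. -/

variable {S T : Type*}

/-- The holomorph of a regular subgroup `N` of `Sym(S)` is the normalizer of `N` in `Sym(S)`. -/
theorem IsRegularSubgroup.hol_eq_normalizer {N : Subgroup (Equiv.Perm S)}
    (hN : IsRegularSubgroup N) (i : S) :
    hN.hol i = Subgroup.normalizer (N : Set (Equiv.Perm S)) := by
  apply le_antisymm
  · intro π hπ
    obtain ⟨a, φ, h⟩ := (hN.mem_hol i π).1 hπ
    -- Conjugation by `π` acts on `N` as `φ` followed by conjugation by `a`.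
    have key : ∀ η : N, π * η * π⁻¹ = (a * φ η * a⁻¹ : N) := by
      intro η
      rw [mul_inv_eq_iff_eq_mul]
      ext s
      obtain ⟨x, hx, -⟩ := hN i s
      have h1 := h (η * x)
      simp only [Subgroup.coe_mul, Equiv.Perm.mul_apply, hx, map_mul] at h1
      have h2 := h x
      rw [hx] at h2
      simp [h1, h2]
    rw [Subgroup.mem_normalizer_iff]
    intro η
    constructor
    · intro hη
      exact (key ⟨η, hη⟩).symm ▸ SetLike.coe_mem _
    · intro hη
      have h3 := key (φ.symm (a⁻¹ * ⟨_, hη⟩ * a))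
      have h4 : a * φ (φ.symm (a⁻¹ * ⟨_, hη⟩ * a)) * a⁻¹ = (⟨_, hη⟩ : N) := by
        rw [MulEquiv.apply_symm_apply]; group
      rw [h4] at h3
      have h5 := mul_left_cancel (mul_right_cancel h3)
      exact h5 ▸ SetLike.coe_mem _
  · intro π hπ
    -- Dividing by `b` leaves a normalizing permutation that fixes `i`; under `σ ↦ σ(i)` such a
    -- permutation acts as conjugation on `N`, an automorphism.
    obtain ⟨b, hb, -⟩ := hN i (π i)
    have hbN : (b : Equiv.Perm S)⁻¹ * π ∈ Subgroup.normalizer (N : Set (Equiv.Perm S)) :=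
      mul_mem (inv_mem (Subgroup.le_normalizer b.2)) hπ
    refine (hN.mem_hol i π).2 ⟨b, N.normalizerMonoidHom ⟨_, hbN⟩, fun x => ?_⟩
    change π ((x : Equiv.Perm S) i) = ((b : Equiv.Perm S) * ((b : Equiv.Perm S)⁻¹ * π * x *
      ((b : Equiv.Perm S)⁻¹ * π)⁻¹)) i
    simp [hb]

theorem IsRegularSubgroup.map_permCongrHom {N : Subgroup (Equiv.Perm S)}
    (hN : IsRegularSubgroup N) (e : S ≃ T) :
    IsRegularSubgroup (N.map e.permCongrHom.toMonoidHom) := by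
  intro i j
  obtain ⟨σ, hσ, huniq⟩ := hN (e.symm i) (e.symm j)
  refine ⟨⟨_, σ, σ.2, rfl⟩, ?_, ?_⟩
  · change e ((σ : Equiv.Perm S) (e.symm i)) = j
    rw [hσ, Equiv.apply_symm_apply]
  · rintro ⟨_, τ, hτ, rfl⟩ h
    have h1 : e (τ (e.symm i)) = j := h
    have := huniq ⟨τ, hτ⟩ (by simp [← h1])
    subst this
    rfl

theorem Subgroup.map_normalizer_permCongrHom (N : Subgroup (Equiv.Perm S)) (e : S ≃ T) :
    (Subgroup.normalizer (N : Set (Equiv.Perm S))).map e.permCongrHom.toMonoidHom =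
      Subgroup.normalizer (N.map e.permCongrHom.toMonoidHom : Set (Equiv.Perm T)) := by
  exact Subgroup.map_equiv_normalizer_eq N e.permCongrHom

end RegularSubgroups

/-! ### The Galois closure and the Galois action on embeddings. -/

section GaloisClosure

variable (k K L : Type*) [Field k] [Field K] [Field L] [Algebra k K] [Algebra k L]

theorem IsNormalClosure.iSup_fieldRange [Algebra.IsAlgebraic k K] [IsNormalClosure k K L] :
    ⨆ f : K →ₐ[k] L, f.fieldRange = ⊤ :=
  (Algebra.IsAlgebraic.isNormalClosure_iff.1 ‹IsNormalClosure k K L›).2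

theorem IsNormalClosure.finiteDimensional [FiniteDimensional k K] [IsNormalClosure k K L] :
    FiniteDimensional k L := by
  have h := normalClosure.is_finiteDimensional k K L
  rw [IntermediateField.normalClosure, IsNormalClosure.iSup_fieldRange] at h
  exact IntermediateField.topEquiv.toLinearEquiv.finiteDimensional

theorem IsNormalClosure.isGalois [Algebra.IsSeparable k K] [IsNormalClosure k K L] :
    IsGalois k L := by
  have : Algebra.IsAlgebraic k K := inferInstance
  refine isGalois_iff.2 ⟨?_, IsNormalClosure.normal (K := K)⟩
  have h : Algebra.IsSeparable k (⨆ f : K →ₐ[k] L, f.fieldRange : IntermediateField k L) := by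
    have : ∀ f : K →ₐ[k] L, Algebra.IsSeparable k f.fieldRange := fun f =>
      Algebra.IsSeparable.of_algHom k K (AlgEquiv.ofInjectiveField f).symm.toAlgHom
    infer_instance
  rw [IsNormalClosure.iSup_fieldRange] at h
  exact Algebra.IsSeparable.of_algHom k _ IntermediateField.topEquiv.symm.toAlgHom

/-- The action of `Gal(L/k)` on the set of `k`-embeddings `K → L`. -/
def galPerm : Gal(L/k) →* Equiv.Perm (K →ₐ[k] L) where
  toFun g :=
    { toFun ρ := (g : L →ₐ[k] L).comp ρ
      invFun ρ := ((g⁻¹ : Gal(L/k)) : L →ₐ[k] L).comp ρ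
      left_inv ρ := by ext x; exact g.symm_apply_apply _
      right_inv ρ := by ext x; exact g.apply_symm_apply _ }
  map_one' := rfl
  map_mul' _ _ := rfl

variable {k K L}

theorem galPerm_apply (g : Gal(L/k)) (ρ : K →ₐ[k] L) (x : K) : galPerm k K L g ρ x = g (ρ x) := rfl

/-- If `g` fixes every embedding, it fixes all their images pointwise, hence their compositum, which
is `L`. -/
theorem galPerm_injective [Algebra.IsAlgebraic k K] [IsNormalClosure k K L] :
    Function.Injective (galPerm k K L) := by
  rw [injective_iff_map_eq_one]
  intro g hg
  have h : (⨆ f : K →ₐ[k] L, f.fieldRange) ≤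
      IntermediateField.fixedField (Subgroup.zpowers g) := by
    refine iSup_le ?_
    rintro f _ ⟨x, rfl⟩
    rw [IntermediateField.mem_fixedField_iff]
    intro g' hg'
    have hg'1 : galPerm k K L g' = 1 := by
      obtain ⟨m, rfl⟩ := hg'
      change galPerm k K L (g ^ m) = 1
      rw [map_zpow, hg, one_zpow]
    exact DFunLike.congr_fun (DFunLike.congr_fun hg'1 f) x
  rw [IsNormalClosure.iSup_fieldRange] at h
  ext x
  exact (IntermediateField.mem_fixedField_iff _ _).1 (h (IntermediateField.mem_top (x := x))) g
    (Subgroup.mem_zpowers g)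

/-- By normality the isomorphism `ρ(K) ≃ τ(K)` over `k` extends to `L`. -/
theorem exists_galPerm_apply_eq [Normal k L] (ρ τ : K →ₐ[k] L) : ∃ g, galPerm k K L g ρ = τ := by
  let χ : ρ.fieldRange ≃ₐ[k] τ.fieldRange :=
    (AlgEquiv.ofInjectiveField ρ).symm.trans (AlgEquiv.ofInjectiveField τ)
  refine ⟨χ.liftNormal L, AlgHom.ext fun x => ?_⟩
  refine (χ.liftNormal_commutes L (AlgEquiv.ofInjectiveField ρ x)).trans ?_
  change ((AlgEquiv.ofInjectiveField τ ((AlgEquiv.ofInjectiveField ρ).symm _) :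
    τ.fieldRange) : L) = _
  rw [AlgEquiv.symm_apply_apply]
  rfl

theorem card_algHom_eq_finrank [FiniteDimensional k K] [Algebra.IsSeparable k K]
    [IsNormalClosure k K L] : Nat.card (K →ₐ[k] L) = Module.finrank k K := by
  rw [Nat.card_eq_fintype_card]
  exact AlgHom.card_of_splits k K L IsNormalClosure.splits

/-- The stabilizer of `ρ` is the fixing subgroup of `ρ(K)`, so this is the Galois correspondence for
that subfield. -/
theorem mem_range_algHom_of_forall_galPerm [FiniteDimensional k L] [IsGalois k L]
    (ρ : K →ₐ[k] L) (y : L) (h : ∀ g, galPerm k K L g ρ = ρ → g y = y) : ∃ x, ρ x = y := by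
  have hy : y ∈ IntermediateField.fixedField ρ.fieldRange.fixingSubgroup := by
    rw [IntermediateField.mem_fixedField_iff]
    intro g hg
    refine h g (AlgHom.ext fun x => ?_)
    exact (IntermediateField.mem_fixingSubgroup_iff _ _).1 hg _ ⟨x, rfl⟩
  rwa [IsGalois.fixedField_fixingSubgroup] at hy

end GaloisClosure

/-! ### Coordinates in tensor squares. -/

section TensorBilinear

variable {k H V : Type*} [CommRing k] [AddCommGroup H] [Module k H] [CommRing V] [Algebra k V]

/-- Coordinates of the tensor square: evaluating `f ⊗ g` on `t` in terms of a basis. -/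
theorem LinearMap.mul'_map_eq_sum {ι : Type*} [Fintype ι] (b : Module.Basis ι k H)
    (f g : H →ₗ[k] V) (t : H ⊗[k] H) :
    LinearMap.mul' k V (TensorProduct.map f g t) =
      ∑ i, ∑ j, (b.tensorProduct b).repr t (i, j) • (f (b i) * g (b j)) := by
  conv_lhs => rw [← (b.tensorProduct b).sum_repr t]
  rw [map_sum, map_sum, Fintype.sum_prod_type]
  simp [Module.Basis.tensorProduct_apply]

end TensorBilinear

/-! ### Consequences of the bijectivity of `(1, μ)` for functionals `K → L`. -/

section EndRank

variable {k : Type*} {H : Type*} {K : Type*} {L : Type*} [Field k] [Field K] [Field L]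
  [Algebra k K] [Algebra k L] [FiniteDimensional k K] [Ring H] [HopfAlgebra k H]
  [Module.Finite k H]

theorem HopfAction.finrank_eq (a : HopfAction k H K) (ha : Function.Bijective a.oneMu) :
    Module.finrank k H = Module.finrank k K := by
  have h := (LinearEquiv.ofBijective _ ha).finrank_eq
  rw [Module.finrank_tensorProduct, Module.finrank_linearMap] at h
  exact Nat.eq_of_mul_eq_mul_left Module.finrank_pos h

/-- The functionals `x ↦ ρ (h x)`, for `h` in a basis of `H`, are linearly independent over `L`. -/
theorem HopfAction.linearIndependent_comp (a : HopfAction k H K) (ha : Function.Bijective a.oneMu)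
    {ι : Type*} [Fintype ι] (b : Module.Basis ι k H) (ρ : K →ₐ[k] L) :
    LinearIndependent L (fun i => ρ.toLinearMap ∘ₗ a.μ (b i)) ∧
      Submodule.span L (Set.range fun i => ρ.toLinearMap ∘ₗ a.μ (b i)) = ⊤ := by
  have hspan : Submodule.span L (Set.range fun i => ρ.toLinearMap ∘ₗ a.μ (b i)) = ⊤ := by
    have h1 : ∀ T : Module.End k K, ρ.toLinearMap ∘ₗ T ∈
        Submodule.span L (Set.range fun i => ρ.toLinearMap ∘ₗ a.μ (b i)) := by
      intro T
      obtain ⟨t, rfl⟩ := ha.2 T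
      induction t with
      | zero => simp
      | add x y hx hy => rw [map_add, LinearMap.comp_add]; exact add_mem hx hy
      | tmul s h =>
        have : ρ.toLinearMap ∘ₗ a.oneMu (s ⊗ₜ h) =
            ∑ i, (ρ s * algebraMap k L (b.repr h i)) • (ρ.toLinearMap ∘ₗ a.μ (b i)) := by
          ext x
          simp only [LinearMap.comp_apply, HopfAction.oneMu_tmul]
          conv_lhs => rw [← b.sum_repr h]
          simp [LinearMap.sum_apply, Finset.mul_sum, Algebra.smul_def, mul_assoc]
        rw [this]
        exact sum_mem fun i _ => Submodule.smul_mem _ _ (Submodule.subset_span ⟨i, rfl⟩)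
    rw [eq_top_iff]
    intro f _
    let c := Module.finBasis k K
    -- Every functional is an `L`-combination of `ρ ∘ T`, with `T` the coordinate forms viewed as
    -- endomorphisms with image in `k`.
    have : f = ∑ i, f (c i) • (ρ.toLinearMap ∘ₗ (c.coord i).smulRight 1) := by
      refine c.ext fun j => ?_
      simp [LinearMap.sum_apply, Finsupp.single_apply]
    rw [this]
    exact sum_mem fun i _ => Submodule.smul_mem _ _ (h1 _)
  refine ⟨linearIndependent_of_top_le_span_of_card_eq_finrank hspan.ge ?_, hspan⟩
  rw [Module.finrank_linearMap_self, ← Module.finrank_eq_card_basis b, a.finrank_eq ha]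

end EndRank

/-! ### From a Hopf action to a regular subgroup. -/

section Forward

variable {k : Type*} {H : Type*} {K : Type*} {L : Type*} [Field k] [Field K] [Field L]
  [Algebra k K] [Algebra k L] [Ring H] [HopfAlgebra k H]
  {ι : Type*} [Fintype ι]

/-- The value `∑ cᵢ ρ(bᵢ x)` of the action on the embedding `ρ` of the element of `L ⊗ H` with
coordinates `c`. -/
noncomputable def HopfAction.twist (a : HopfAction k H K) (b : Module.Basis ι k H)
    (ρ : K →ₐ[k] L) (c : ι → L) : K →ₗ[k] L :=
  ∑ i, c i • (ρ.toLinearMap ∘ₗ a.μ (b i))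

theorem HopfAction.twist_apply (a : HopfAction k H K) (b : Module.Basis ι k H) (ρ : K →ₐ[k] L)
    (c : ι → L) (x : K) : a.twist b ρ c x = ∑ i, c i * ρ (a.μ (b i) x) := by
  simp [HopfAction.twist, LinearMap.sum_apply]

theorem HopfAction.twist_injective (a : HopfAction k H K) (ha : Function.Bijective a.oneMu)
    [FiniteDimensional k K] [Module.Finite k H] (b : Module.Basis ι k H) (ρ : K →ₐ[k] L) :
    Function.Injective (a.twist b ρ) :=
  linearIndependent_iff_injective_fintypeLinearCombination.1 (a.linearIndependent_comp ha b ρ).1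

theorem HopfAction.twist_surjective (a : HopfAction k H K) (ha : Function.Bijective a.oneMu)
    [FiniteDimensional k K] [Module.Finite k H] (b : Module.Basis ι k H) (ρ : K →ₐ[k] L) :
    Function.Surjective (a.twist b ρ) := by
  intro f
  have hf : f ∈ Submodule.span L (Set.range fun i => ρ.toLinearMap ∘ₗ a.μ (b i)) := by
    rw [(a.linearIndependent_comp ha b ρ).2]; trivial
  exact Submodule.mem_span_range_iff_exists_fun L |>.1 hf

/-- The coordinates of the product in `L ⊗ H`. -/
noncomputable def twistMul (b : Module.Basis ι k H) (c d : ι → L) : ι → L :=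
  fun m => ∑ i, ∑ j, c i * d j * algebraMap k L (b.repr (b i * b j) m)

/-- This is associativity of the action over `L ⊗ H`. The left factor acts first on embeddings,
since `H` acts on the argument of `ρ`; products of permutations therefore correspond to opposite
products in `L ⊗ H`. -/
theorem HopfAction.twist_twistMul (a : HopfAction k H K) (b : Module.Basis ι k H)
    (ρ τ : K →ₐ[k] L) (c d : ι → L) (h : a.twist b ρ c = τ.toLinearMap) :
    a.twist b ρ (twistMul b c d) = a.twist b τ d := by
  ext x
  have h1 : ∀ i j, ρ (a.μ (b i) (a.μ (b j) x)) =
      ∑ m, algebraMap k L (b.repr (b i * b j) m) * ρ (a.μ (b m) x) := by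
    intro i j
    rw [← Module.End.mul_apply, ← _root_.map_mul]
    conv_lhs => rw [← b.sum_repr (b i * b j)]
    simp [LinearMap.sum_apply, Algebra.smul_def]
  have h2 : ∀ y, τ y = ∑ i, c i * ρ (a.μ (b i) y) := by
    intro y
    rw [← HopfAction.twist_apply, h]; rfl
  simp only [HopfAction.twist_apply, twistMul, h2, h1, Finset.sum_mul, Finset.mul_sum]
  rw [Finset.sum_comm]
  conv_rhs => rw [Finset.sum_comm]
  refine Finset.sum_congr rfl fun i _ => ?_
  rw [Finset.sum_comm]
  exact Finset.sum_congr rfl fun j _ => Finset.sum_congr rfl fun m _ => by ring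

/-- Being group-like is a property of `c` alone. It is read off at `ρ`, where the result `τ` is an
algebra homomorphism, and then gives multiplicativity at every `ρ'`. -/
theorem HopfAction.exists_twist_eq (a : HopfAction k H K) (ha : Function.Bijective a.oneMu)
    [FiniteDimensional k K] [Module.Finite k H] (b : Module.Basis ι k H) (ρ τ : K →ₐ[k] L) :
    ∃ c : ι → L, a.twist b ρ c = τ.toLinearMap ∧
      ∀ ρ' : K →ₐ[k] L, ∃ τ' : K →ₐ[k] L, a.twist b ρ' c = τ'.toLinearMap := by
  obtain ⟨c, hc⟩ := a.twist_surjective ha b ρ τ.toLinearMap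
  refine ⟨c, hc, fun ρ' => ?_⟩
  have hone : ∀ ρ'' : K →ₐ[k] L, a.twist b ρ'' c 1 =
      ∑ i, c i * algebraMap k L (Coalgebra.counit (R := k) (b i)) := by
    intro ρ''
    simp [HopfAction.twist_apply, a.map_one]
  let Δ : ι → ι → ι → k := fun i j l =>
    (b.tensorProduct b).repr (Coalgebra.comul (R := k) (b i)) (j, l)
  have hmul : ∀ (ρ'' : K →ₐ[k] L) (x y : K), a.twist b ρ'' c (x * y) =
      ∑ j, ∑ l, (∑ i, c i * algebraMap k L (Δ i j l)) *
        (ρ'' (a.μ (b j) x) * ρ'' (a.μ (b l) y)) := by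
    intro ρ'' x y
    have h1 : ∀ i, ρ'' (a.μ (b i) (x * y)) =
        ∑ j, ∑ l, algebraMap k L (Δ i j l) * (ρ'' (a.μ (b j) x) * ρ'' (a.μ (b l) y)) := by
      intro i
      rw [a.map_mul, LinearMap.mul'_map_eq_sum b]
      simp [Algebra.smul_def, Δ]
    simp only [HopfAction.twist_apply, h1, Finset.mul_sum, Finset.sum_mul]
    rw [Finset.sum_comm]
    refine Finset.sum_congr rfl fun j _ => ?_
    rw [Finset.sum_comm]
    simp only [mul_assoc]
  have hprod : ∀ (ρ'' : K →ₐ[k] L) (x y : K), a.twist b ρ'' c x * a.twist b ρ'' c y =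
      ∑ j, ∑ l, (c j * c l) * (ρ'' (a.μ (b j) x) * ρ'' (a.μ (b l) y)) := by
    intro ρ'' x y
    simp only [HopfAction.twist_apply, Finset.sum_mul_sum]
    exact Finset.sum_congr rfl fun j _ => Finset.sum_congr rfl fun l _ => by ring
  have hinj : ∀ e : ι → L, (∀ x, ∑ i, e i * ρ (a.μ (b i) x) = 0) → ∀ i, e i = 0 := by
    intro e he
    have : e = 0 := a.twist_injective ha b ρ (by
      ext x
      rw [HopfAction.twist_apply, he]
      simp [HopfAction.twist_apply])
    exact fun i => congrFun this i
  -- The group-like equation `Δ(c) = c ⊗ c` in coordinates: the expansions of `τ(xy)` and `τ(x)τ(y)`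
  -- agree, and independence is applied once for each tensor factor.
  have hgl : ∀ j l, ∑ i, c i * algebraMap k L (Δ i j l) = c j * c l := by
    intro j l
    rw [← sub_eq_zero]
    refine hinj (fun l => ∑ i, c i * algebraMap k L (Δ i j l) - c j * c l) (fun y => ?_) l
    refine hinj (fun j => ∑ l, (∑ i, c i * algebraMap k L (Δ i j l) - c j * c l) *
      ρ (a.μ (b l) y)) (fun x => ?_) j
    have h1 := hmul ρ x y
    have h2 := hprod ρ x y
    rw [hc] at h1 h2
    have h3 : τ.toLinearMap (x * y) = τ.toLinearMap x * τ.toLinearMap y := _root_.map_mul τ x y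
    rw [← h3, h1, ← sub_eq_zero] at h2
    rw [← h2, ← Finset.sum_sub_distrib]
    refine Finset.sum_congr rfl fun j _ => ?_
    rw [← Finset.sum_sub_distrib, Finset.sum_mul]
    exact Finset.sum_congr rfl fun l _ => by ring
  -- The value at `1` is `ε(c)` for every embedding, and it equals `1` at `ρ`.
  refine ⟨AlgHom.ofLinearMap (a.twist b ρ' c) ?_ fun x y => ?_, rfl⟩
  · rw [hone, ← hone ρ, hc]
    exact _root_.map_one τ
  · rw [hmul, hprod]
    simp only [hgl]

/-- `N` consists of the permutations induced by elements of `L ⊗ H` that carry embeddings to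
embeddings. Existence in regularity is `HopfAction.exists_twist_eq`; uniqueness is injectivity of
`twist` at a single embedding. -/
theorem IsHopfGalois.exists_isRegularSubgroup {K : Type*} [Field K] [Algebra k K]
    [FiniteDimensional k K] (L : Type*) [Field L] [Algebra k L] (h : IsHopfGalois k K) :
    ∃ N : Subgroup (Equiv.Perm (K →ₐ[k] L)), IsRegularSubgroup N ∧
      (galPerm k K L).range ≤ Subgroup.normalizer (N : Set (Equiv.Perm (K →ₐ[k] L))) := by
  obtain ⟨H, _, _, _, -, a, ha⟩ := h
  let b := Module.finBasis k H
  have : Finite (K →ₐ[k] L) := inferInstance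
  let M : Submonoid (Equiv.Perm (K →ₐ[k] L)) :=
    { carrier := {π | ∃ c, ∀ ρ, a.twist b ρ c = (π ρ).toLinearMap}
      one_mem' := by
        refine ⟨fun i => algebraMap k L (b.repr 1 i), fun ρ => ?_⟩
        ext x
        have h1 : ρ (a.μ 1 x) = ρ x := by simp
        rw [← b.sum_repr 1] at h1
        simpa [HopfAction.twist_apply, LinearMap.sum_apply, Algebra.smul_def] using h1
      mul_mem' := by
        rintro π π' ⟨c, hc⟩ ⟨c', hc'⟩
        exact ⟨twistMul b c' c, fun ρ => by
          rw [a.twist_twistMul b ρ _ _ _ (hc' ρ), hc]; rfl⟩ }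
  let N : Subgroup (Equiv.Perm (K →ₐ[k] L)) :=
    { M with
      inv_mem' := by
        intro π hπ
        -- In a finite group the inverse of `π` is a power of `π`.
        obtain ⟨m, hm⟩ := (isOfFinOrder_of_finite π).mem_powers_iff_mem_zpowers.2
          (Subgroup.inv_mem _ (Subgroup.mem_zpowers π))
        have hm' : π ^ m = π⁻¹ := hm
        rw [← hm']
        exact pow_mem (show π ∈ M from hπ) m }
  have hNmem : ∀ π, π ∈ N ↔ ∃ c, ∀ ρ, a.twist b ρ c = (π ρ).toLinearMap := fun π => Iff.rfl
  refine ⟨N, fun ρ τ => ?_, ?_⟩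
  · obtain ⟨c, hc, hc'⟩ := a.exists_twist_eq ha b ρ τ
    choose f hf using hc'
    have hfρ : f ρ = τ := AlgHom.toLinearMap_injective (by rw [← hf, hc])
    -- If `d` carries `τ` back to `ρ`, then the product of `c` and `d` acts as the identity at `ρ`;
    -- by injectivity it is the unit of `L ⊗ H`, so `d` undoes `f` everywhere.
    have hfinj : Function.Injective f := by
      obtain ⟨d, hd, -⟩ := a.exists_twist_eq ha b τ ρ
      intro ρ₁ ρ₂ h12
      have key : ∀ ρ', a.twist b (f ρ') d = ρ'.toLinearMap := by
        obtain ⟨e, he⟩ := (hNmem 1).1 N.one_mem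
        have h1 : twistMul b c d = e := a.twist_injective ha b ρ (by
          rw [a.twist_twistMul b ρ τ c d hc, hd, he]; rfl)
        intro ρ'
        rw [← a.twist_twistMul b ρ' (f ρ') c d (hf ρ'), h1, he]
        rfl
      have h3 := key ρ₁
      rw [h12, key ρ₂] at h3
      exact (AlgHom.toLinearMap_injective h3).symm
    refine ⟨⟨Equiv.ofBijective f (Finite.injective_iff_bijective.1 hfinj), c, hf⟩, hfρ, ?_⟩
    rintro ⟨π, c', hπ⟩ h'
    have hcc : c' = c := a.twist_injective ha b ρ (by
      rw [hπ, hc]; exact congrArg AlgHom.toLinearMap h')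
    subst hcc
    ext1
    ext1 ρ'
    exact AlgHom.toLinearMap_injective ((hπ ρ').symm.trans (hf ρ'))
  · have key : ∀ g π, π ∈ N → galPerm k K L g * π * (galPerm k K L g)⁻¹ ∈ N := by
      rintro g π ⟨c, hc⟩
      -- Conjugation by `g` amounts to applying `g` to the `L`-coefficients.
      refine ⟨fun i => g (c i), fun ρ => ?_⟩
      ext x
      have h1 := congrArg g (LinearMap.congr_fun (hc ((galPerm k K L g)⁻¹ ρ)) x)
      have h2 : ∀ y, g ((galPerm k K L g)⁻¹ ρ y) = ρ y := fun y => by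
        exact DFunLike.congr_fun ((galPerm k K L g).apply_symm_apply ρ) y
      simp only [HopfAction.twist_apply, map_sum, map_mul, h2] at h1 ⊢
      exact h1
    rintro _ ⟨g, rfl⟩
    rw [Subgroup.mem_normalizer_iff]
    refine fun π => ⟨key g π, fun h => ?_⟩
    have := key g⁻¹ _ h
    rw [map_inv] at this
    simpa [mul_assoc] using this

end Forward

/-! ### Galois descent for equivariant functions. -/

section Descent

variable {k L X : Type*} [Field k] [Field L] [Algebra k L]

/-- A function `c : X → L` on a `Gal(L/k)`-set `X` is equivariant if `c (g x) = g (c x)`. -/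
def IsEquivariant (φ : Gal(L/k) →* Equiv.Perm X) (c : X → L) : Prop :=
  ∀ g x, c (φ g x) = g (c x)

variable [FiniteDimensional k L] {φ : Gal(L/k) →* Equiv.Perm X}

/-- The equivariant functions on a finite `Gal(L/k)`-set `X` span all functions `X → L`. -/
theorem span_isEquivariant_eq_top (φ : Gal(L/k) →* Equiv.Perm X) :
    Submodule.span L {c : X → L | IsEquivariant φ c} = ⊤ := by
  by_contra hne
  obtain ⟨f, hf0, hf⟩ := Submodule.exists_le_ker_of_lt_top _ (lt_top_iff_ne_top.2 hne)
  refine hf0 (LinearMap.ext fun c => ?_)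
  -- A functional `f` killing equivariant functions kills all these averages. As `l` varies,
  -- Dedekind independence isolates the summand at `g = 1`, which gives `f c = 0`.
  have havg : ∀ l : L, IsEquivariant φ
      (∑ g : Gal(L/k), g l • fun x => g (c (φ g⁻¹ x)) : X → L) := by
    intro l h x
    simp only [Finset.sum_apply, Pi.smul_apply, smul_eq_mul, map_sum, map_mul]
    refine Fintype.sum_equiv (Equiv.mulLeft h⁻¹) _ _ fun g => ?_
    have h1 : ∀ y, h ((h⁻¹ * g) y) = g y := fun y => by
      rw [← AlgEquiv.mul_apply, mul_inv_cancel_left]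
    have h2 : φ (h⁻¹ * g)⁻¹ x = φ g⁻¹ (φ h x) := by
      rw [← Equiv.Perm.mul_apply, ← map_mul, mul_inv_rev, inv_inv]
    simp only [Equiv.coe_mulLeft, h1, h2]
  have hli := linearIndependent_monoidHom L L
  have hinj : Function.Injective (fun g : Gal(L/k) => ((g : L →* L))) := fun g h hgh =>
    AlgEquiv.ext fun x => DFunLike.congr_fun hgh x
  have h0 := Fintype.linearIndependent_iff.1 (hli.comp _ hinj)
    (fun g => f (fun x => g (c (φ g⁻¹ x)))) (by
      funext l
      have := LinearMap.mem_ker.1 (hf (Submodule.subset_span (havg l)))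
      rw [map_sum] at this
      simpa [mul_comm] using this) 1
  simpa using h0

theorem exists_basis_isEquivariant [Finite X] (φ : Gal(L/k) →* Equiv.Perm X) :
    ∃ B : Module.Basis X L (X → L), ∀ x, IsEquivariant φ (B x) := by
  let B₀ := Module.Basis.ofSpan (span_isEquivariant_eq_top φ).ge
  refine ⟨B₀.reindex (B₀.indexEquiv (Pi.basisFun L X)), fun x => ?_⟩
  rw [Module.Basis.reindex_apply]
  exact Module.Basis.ofSpan_subset (span_isEquivariant_eq_top φ).ge ⟨_, rfl⟩

/-- The coordinates of an equivariant function in a basis of equivariant functions are in `k`. -/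
theorem IsEquivariant.repr_mem_range [IsGalois k L] {ι : Type*} [Fintype ι]
    (B : Module.Basis ι L (X → L)) (hB : ∀ i, IsEquivariant φ (B i)) {c : X → L}
    (hc : IsEquivariant φ c) (i : ι) : B.repr c i ∈ Set.range (algebraMap k L) := by
  rw [IsGalois.mem_range_algebraMap_iff_fixed]
  intro g
  -- Applying `g` to the coordinates gives another expansion of `c`, so uniqueness makes each
  -- coordinate `g`-invariant.
  have h : ∑ i, g (B.repr c i) • B i = c := by
    funext x
    obtain ⟨x, rfl⟩ := (φ g).surjective x
    rw [hc g x]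
    conv_rhs => rw [← B.sum_repr c]
    simp [hB _ g x, map_sum]
  have h1 := congrArg (fun c => B.repr c i) h
  simp only [B.repr_sum_self (fun i => g (B.repr c i))] at h1
  exact h1

/-- Galois descent for the `k`-space `V` of equivariant functions on `X`. -/
theorem exists_basis_of_isEquivariant_iff [IsGalois k L] [Fintype X] {V : Type*} [AddCommGroup V]
    [Module k V] (f : V →ₗ[k] X → L) (hf : Function.Injective f)
    (hfφ : ∀ c, IsEquivariant φ c ↔ ∃ v, f v = c) :
    ∃ (b : Module.Basis X k V) (B : Module.Basis X L (X → L)), ∀ x, f (b x) = B x := by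
  obtain ⟨B, hB⟩ := exists_basis_isEquivariant φ
  choose v hv using fun x => (hfφ _).1 (hB x)
  have hli : LinearIndependent k v := by
    refine Fintype.linearIndependent_iff.2 fun r hr x => ?_
    have h1 := congrArg f hr
    rw [map_sum, map_zero] at h1
    have h2 := Fintype.linearIndependent_iff.1 B.linearIndependent
      (fun x => algebraMap k L (r x)) (by simpa [hv] using h1) x
    exact (map_eq_zero _).1 h2
  refine ⟨Module.Basis.mk hli ?_, B, fun x => by rw [Module.Basis.mk_apply, hv]⟩
  intro u _
  choose r hr using fun x => ((hfφ _).2 ⟨u, rfl⟩).repr_mem_range B hB x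
  have : u = ∑ x, r x • v x := by
    apply hf
    rw [map_sum]
    conv_lhs => rw [← B.sum_repr (f u)]
    refine Finset.sum_congr rfl fun x _ => ?_
    rw [map_smul, hv, ← hr, algebraMap_smul]
  rw [this]
  exact sum_mem fun x _ => Submodule.smul_mem _ _ (Submodule.subset_span ⟨x, rfl⟩)

end Descent

/-! ### Separating elements of tensor products by `L`-valued functionals. -/

section JointlyIndependent

variable {k L V W X Y ι κ : Type*} [Field k] [Field L] [Algebra k L] [AddCommGroup V] [Module k V]
  [AddCommGroup W] [Module k W] [Fintype ι] [Fintype κ]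

/-- The tensor product `v ⊗ w ↦ f v * g w` of two functionals with values in `L`. -/
noncomputable def tensorEval (f : V →ₗ[k] L) (g : W →ₗ[k] L) : V ⊗[k] W →ₗ[k] L :=
  LinearMap.mul' k L ∘ₗ TensorProduct.map f g

@[simp]
theorem tensorEval_tmul (f : V →ₗ[k] L) (g : W →ₗ[k] L) (v : V) (w : W) :
    tensorEval f g (v ⊗ₜ w) = f v * g w := rfl

/-- A family of `L`-valued functionals on a `k`-space `V` with basis `b` such that the induced
functions attached to the elements of `b` are linearly independent over `L`. -/
def JointlyIndependent (b : Module.Basis ι k V) (f : X → V →ₗ[k] L) : Prop :=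
  LinearIndependent L fun i => (fun x => f x (b i) : X → L)

theorem JointlyIndependent.eq_of_forall_eq {b : Module.Basis ι k V} {f : X → V →ₗ[k] L}
    (h : JointlyIndependent b f) {v w : V} (hvw : ∀ x, f x v = f x w) : v = w := by
  rw [← sub_eq_zero]
  have h1 := Fintype.linearIndependent_iff.1 h (fun i => algebraMap k L (b.repr (v - w) i)) (by
    funext x
    have h2 : f x (v - w) = 0 := by rw [map_sub, hvw, sub_self]
    rw [← b.sum_repr (v - w)] at h2
    simpa [Algebra.smul_def] using h2)
  refine b.ext_elem fun i => ?_
  rw [map_zero, Finsupp.zero_apply]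
  exact (map_eq_zero _).1 (h1 i)

/-- Fixing `y`, independence for `f` kills the inner sums; independence for `g` then kills the
coefficients. Identities in tensor powers can thus be tested on pairs and triples of group elements.
-/
theorem JointlyIndependent.tensor {b : Module.Basis ι k V} {f : X → V →ₗ[k] L}
    (hf : JointlyIndependent b f) {b' : Module.Basis κ k W} {g : Y → W →ₗ[k] L}
    (hg : JointlyIndependent b' g) :
    JointlyIndependent (b.tensorProduct b') fun p : X × Y => tensorEval (f p.1) (g p.2) := by
  refine Fintype.linearIndependent_iff.2 fun c hc => ?_
  rintro ⟨i, j⟩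
  have h : ∀ x y, ∑ i, (∑ j, c (i, j) * g y (b' j)) * f x (b i) = 0 := by
    intro x y
    have := congrFun hc (x, y)
    simp only [Finset.sum_apply, Pi.smul_apply, smul_eq_mul, Module.Basis.tensorProduct_apply,
      tensorEval_tmul, Fintype.sum_prod_type, Pi.zero_apply] at this
    rw [← this]
    refine Finset.sum_congr rfl fun i _ => ?_
    rw [Finset.sum_mul]
    exact Finset.sum_congr rfl fun j _ => by ring
  refine Fintype.linearIndependent_iff.1 hg (fun j => c (i, j)) ?_ j
  funext y
  have := Fintype.linearIndependent_iff.1 hf (fun i => ∑ j, c (i, j) * g y (b' j)) (by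
    funext x
    simpa using h x y) i
  simpa using this

end JointlyIndependent

/-! ### Endomorphisms of `K` given by invariants of `L[N]`. -/

section TwistedCombination

variable {k K L : Type*} [Field k] [Field K] [Field L] [Algebra k K] [Algebra k L]
  {N : Subgroup (Equiv.Perm (K →ₐ[k] L))}

/-- The action of `Gal(L/k)` by conjugation on a subgroup of `Sym(K →ₐ[k] L)` which it
normalizes. -/
def galConj (hG : (galPerm k K L).range ≤ Subgroup.normalizer (N : Set _)) :
    Gal(L/k) →* MulAut N :=
  N.normalizerMonoidHom.comp ((galPerm k K L).codRestrict _ fun g => hG ⟨g, rfl⟩)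

theorem coe_galConj_apply (hG : (galPerm k K L).range ≤ Subgroup.normalizer (N : Set _))
    (g : Gal(L/k)) (η : N) :
    (galConj hG g η : Equiv.Perm (K →ₐ[k] L)) = galPerm k K L g * η * (galPerm k K L g)⁻¹ := rfl

theorem galConj_apply_galPerm
    (hG : (galPerm k K L).range ≤ Subgroup.normalizer (N : Set (Equiv.Perm (K →ₐ[k] L))))
    (g : Gal(L/k)) (η : N) (ρ : K →ₐ[k] L) (x : K) :
    (galConj hG g η : Equiv.Perm (K →ₐ[k] L)) (galPerm k K L g ρ) x =
      g ((η : Equiv.Perm (K →ₐ[k] L)) ρ x) := by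
  rw [coe_galConj_apply]
  simp [galPerm_apply]

variable [Fintype N]

/-- `T` acts on the embeddings `K → L` as the element of `L[N]` with coefficients `c`:
`ρ ∘ T = ∑ c η • η(ρ)`. -/
def IsTwistedCombination (T : Module.End k K) (c : N → L) : Prop :=
  ∀ (ρ : K →ₐ[k] L) (x : K), ρ (T x) = ∑ η : N, c η * (η : Equiv.Perm (K →ₐ[k] L)) ρ x

/-- By regularity the embeddings `η(ρ)` are distinct, so Dedekind independence applies. -/
theorem IsRegularSubgroup.eq_zero_of_sum_eq_zero (hN : IsRegularSubgroup N) (ρ : K →ₐ[k] L)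
    {c : N → L} (h : ∀ x, ∑ η : N, c η * (η : Equiv.Perm (K →ₐ[k] L)) ρ x = 0) (η : N) :
    c η = 0 := by
  have hinj : Function.Injective fun η : N => (η : Equiv.Perm (K →ₐ[k] L)) ρ :=
    ((Function.bijective_iff_existsUnique _).2 (hN ρ)).1
  refine Fintype.linearIndependent_iff.1
    ((linearIndependent_algHom_toLinearMap k K L).comp _ hinj) c ?_ η
  ext x
  simpa [LinearMap.sum_apply] using h x

namespace IsTwistedCombination

theorem coeff_unique (hN : IsRegularSubgroup N) (ρ : K →ₐ[k] L) {T : Module.End k K} {c d : N → L}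
    (hc : IsTwistedCombination T c) (hd : IsTwistedCombination T d) : c = d := by
  funext η
  rw [← sub_eq_zero]
  refine hN.eq_zero_of_sum_eq_zero ρ (c := fun η => c η - d η) (fun x => ?_) η
  simp only [sub_mul, Finset.sum_sub_distrib]
  rw [← hc ρ x, ← hd ρ x, sub_self]

theorem end_unique (ρ : K →ₐ[k] L) {T T' : Module.End k K} {c : N → L}
    (h : IsTwistedCombination T c) (h' : IsTwistedCombination T' c) : T = T' :=
  LinearMap.ext fun x => ρ.injective ((h ρ x).trans (h' ρ x).symm)

theorem add {T T' : Module.End k K} {c d : N → L}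
    (h : IsTwistedCombination T c) (h' : IsTwistedCombination T' d) :
    IsTwistedCombination (T + T') (c + d) := by
  intro ρ x
  simp [h ρ x, h' ρ x, add_mul, Finset.sum_add_distrib]

theorem smul (r : k) {T : Module.End k K} {c : N → L} (h : IsTwistedCombination T c) :
    IsTwistedCombination (r • T) (r • c) := by
  intro ρ x
  simp [h ρ x, Finset.smul_sum]

theorem algebraMap_end [DecidableEq N] (r : k) :
    IsTwistedCombination (algebraMap k (Module.End k K) r)
      (Pi.single (1 : N) (algebraMap k L r)) := by
  intro ρ x
  simp [Pi.single_apply, ite_mul, Algebra.smul_def]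

/-- Expanding `ρ ∘ T ∘ T'` puts `η'` from `T'` to the left of `η` from `T`; the convolution is that
of the opposite group algebra. -/
theorem mul {T T' : Module.End k K} {c d : N → L}
    (h : IsTwistedCombination T c) (h' : IsTwistedCombination T' d) :
    IsTwistedCombination (T * T') fun ζ => ∑ η, c η * d (ζ * η⁻¹) := by
  intro ρ x
  rw [Module.End.mul_apply, h]
  simp only [Finset.sum_mul]
  rw [Finset.sum_comm]
  refine Finset.sum_congr rfl fun η _ => ?_
  rw [h', Finset.mul_sum]
  refine Fintype.sum_equiv (Equiv.mulRight η) _ _ fun η' => ?_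
  simp [mul_assoc]

variable (hG : (galPerm k K L).range ≤ Subgroup.normalizer (N : Set (Equiv.Perm (K →ₐ[k] L))))

theorem isEquivariant (hN : IsRegularSubgroup N) (ρ : K →ₐ[k] L) {T : Module.End k K} {c : N → L}
    (h : IsTwistedCombination T c) :
    IsEquivariant ((MulAut.toPerm N).comp (galConj hG)) c := by
  intro g η
  change c (galConj hG g η) = g (c η)
  rw [← sub_eq_zero]
  -- Applying `g` to the expansion at `ρ` gives an expansion at `gρ` with conjugated coefficients,
  -- to be compared with the original one there.
  have h1 := hN.eq_zero_of_sum_eq_zero (galPerm k K L g ρ)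
    (c := fun η => c η - g (c ((galConj hG g).symm η))) (fun x => ?_) (galConj hG g η)
  · simpa using h1
  · simp only [sub_mul, Finset.sum_sub_distrib]
    rw [← h, galPerm_apply, h, map_sum, sub_eq_zero]
    refine Fintype.sum_equiv (galConj hG g).toEquiv _ _ fun η => ?_
    simp [galConj_apply_galPerm]

theorem exists_end [FiniteDimensional k L] [IsGalois k L] (ρ : K →ₐ[k] L) {c : N → L}
    (hc : IsEquivariant ((MulAut.toPerm N).comp (galConj hG)) c) :
    ∃ T : Module.End k K, IsTwistedCombination T c := by
  have hg : ∀ (g : Gal(L/k)) (τ : K →ₐ[k] L) (x : K),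
      g (∑ η : N, c η * (η : Equiv.Perm (K →ₐ[k] L)) τ x) =
        ∑ η : N, c η * (η : Equiv.Perm (K →ₐ[k] L)) (galPerm k K L g τ) x := by
    intro g τ x
    rw [map_sum]
    refine Fintype.sum_equiv (galConj hG g).toEquiv _ _ fun η => ?_
    have h1 : c (galConj hG g η) = g (c η) := hc g η
    simp [galConj_apply_galPerm, h1]
  -- By equivariance the sum at `ρ` is fixed by the stabilizer of `ρ`, so it lies in `ρ(K)`.
  -- Transitivity later carries the formula to all embeddings.
  have hex : ∀ x, ∃ y, ρ y = ∑ η : N, c η * (η : Equiv.Perm (K →ₐ[k] L)) ρ x := fun x =>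
    mem_range_algHom_of_forall_galPerm ρ _ fun g hgρ => by rw [hg, hgρ]
  choose f hf using hex
  have hadd : ∀ x y, f (x + y) = f x + f y := fun x y => ρ.injective (by
    simp [hf, mul_add, Finset.sum_add_distrib])
  have hsmul : ∀ (r : k) x, f (r • x) = r • f x := fun r x => ρ.injective (by
    simp [hf, Finset.smul_sum])
  refine ⟨⟨⟨f, hadd⟩, hsmul⟩, fun τ x => ?_⟩
  obtain ⟨g, rfl⟩ := exists_galPerm_apply_eq ρ τ
  rw [← hg, ← hf]
  rfl

end IsTwistedCombination

variable (N) in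
/-- The `k`-algebra of endomorphisms of `K` which act on the embeddings `K → L` as elements of
`L[N]`. -/
def twistedAlgebra : Subalgebra k (Module.End k K) where
  carrier := {T | ∃ c : N → L, IsTwistedCombination T c}
  mul_mem' := by
    rintro T T' ⟨c, hc⟩ ⟨d, hd⟩
    exact ⟨_, hc.mul hd⟩
  add_mem' := by
    rintro T T' ⟨c, hc⟩ ⟨d, hd⟩
    exact ⟨_, hc.add hd⟩
  algebraMap_mem' r := by
    classical
    exact ⟨_, IsTwistedCombination.algebraMap_end r⟩

namespace IsRegularSubgroup

/-- The coefficients in `L[N]` of an element of `twistedAlgebra N`. -/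
noncomputable def coeff (hN : IsRegularSubgroup N) (ρ : K →ₐ[k] L) :
    twistedAlgebra N →ₗ[k] N → L where
  toFun T := T.2.choose
  map_add' T T' := (T + T').2.choose_spec.coeff_unique hN ρ
    (T.2.choose_spec.add T'.2.choose_spec)
  map_smul' r T := (r • T).2.choose_spec.coeff_unique hN ρ (T.2.choose_spec.smul r)

variable (hN : IsRegularSubgroup N) (ρ : K →ₐ[k] L)

theorem isTwistedCombination_coeff (T : twistedAlgebra N) :
    IsTwistedCombination (T : Module.End k K) (hN.coeff ρ T) :=
  T.2.choose_spec

theorem coeff_eq {T : twistedAlgebra N} {c : N → L}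
    (h : IsTwistedCombination (T : Module.End k K) c) : hN.coeff ρ T = c :=
  (hN.isTwistedCombination_coeff ρ T).coeff_unique hN ρ h

theorem coeff_injective : Function.Injective (hN.coeff ρ) := fun T T' h =>
  Subtype.ext ((hN.isTwistedCombination_coeff ρ T).end_unique ρ
    (h ▸ hN.isTwistedCombination_coeff ρ T'))

theorem coeff_mul (T T' : twistedAlgebra N) (ζ : N) :
    hN.coeff ρ (T * T') ζ = ∑ η, hN.coeff ρ T η * hN.coeff ρ T' (ζ * η⁻¹) :=
  congrFun (hN.coeff_eq ρ (T := T * T') ((hN.isTwistedCombination_coeff ρ T).mul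
    (hN.isTwistedCombination_coeff ρ T'))) ζ

theorem coeff_algebraMap [DecidableEq N] (r : k) :
    hN.coeff ρ (algebraMap k (twistedAlgebra N) r) = Pi.single 1 (algebraMap k L r) :=
  hN.coeff_eq ρ (IsTwistedCombination.algebraMap_end r)

theorem coeff_one [DecidableEq N] : hN.coeff ρ 1 = Pi.single 1 1 := by
  rw [← map_one (algebraMap k (twistedAlgebra N)), coeff_algebraMap, map_one]

end IsRegularSubgroup

end TwistedCombination

/-! ### Descent of the Hopf structure to forms of a group algebra. -/

section GroupAlgebraForm

variable (k L A Γ : Type*) [Field k] [Field L] [Algebra k L] [Ring A] [Algebra k A] [Group Γ]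
  [Fintype Γ] [DecidableEq Γ]

/-- An identification of a `k`-algebra `A` with the algebra of invariants of the (opposite) group
algebra `L[Γ]`, for an action of `Gal(L/k)` on `Γ` by automorphisms. -/
structure GroupAlgebraForm where
  /-- the action of the Galois group on `Γ` -/
  act : Gal(L/k) →* MulAut Γ
  /-- the coefficients in `L[Γ]` of an element of `A` -/
  coeff : A →ₗ[k] Γ → L
  coeff_injective : Function.Injective coeff
  isEquivariant_iff : ∀ c : Γ → L,
    IsEquivariant ((MulAut.toPerm Γ).comp act) c ↔ ∃ a, coeff a = c
  coeff_one : coeff 1 = Pi.single 1 1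
  coeff_mul : ∀ a a' ζ, coeff (a * a') ζ = ∑ η, coeff a η * coeff a' (ζ * η⁻¹)

namespace GroupAlgebraForm

variable {k L A Γ} (F : GroupAlgebraForm k L A Γ)

/-- The coefficient of `η`, as a functional. -/
noncomputable def ev (η : Γ) : A →ₗ[k] L := LinearMap.proj η ∘ₗ F.coeff

theorem ext_ev {a a' : A} (h : ∀ η, F.ev η a = F.ev η a') : a = a' :=
  F.coeff_injective (funext h)

theorem ev_act (g : Gal(L/k)) (η : Γ) (a : A) : F.ev (F.act g η) a = g (F.ev η a) :=
  (F.isEquivariant_iff _).2 ⟨a, rfl⟩ g η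

theorem ev_one (η : Γ) : F.ev η 1 = if η = 1 then 1 else 0 := by
  change F.coeff 1 η = _
  rw [F.coeff_one, Pi.single_apply]

theorem ev_algebraMap (η : Γ) (r : k) :
    F.ev η (algebraMap k A r) = if η = 1 then algebraMap k L r else 0 := by
  rw [Algebra.algebraMap_eq_smul_one, map_smul, ev_one, Algebra.smul_def, mul_ite, mul_one,
    mul_zero]

theorem ev_smul (η : Γ) (r : k) (a : A) : F.ev η (r • a) = algebraMap k L r * F.ev η a := by
  rw [map_smul, Algebra.smul_def]

theorem ev_mul (ζ : Γ) (a a' : A) :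
    F.ev ζ (a * a') = ∑ η, F.ev η a * F.ev (ζ * η⁻¹) a' :=
  F.coeff_mul a a' ζ

/-- The coefficient of `(η, η')` in `L[Γ × Γ]` of an element of `A ⊗ A`. -/
noncomputable def ev₂ (η η' : Γ) : A ⊗[k] A →ₗ[k] L := tensorEval (F.ev η) (F.ev η')

@[simp]
theorem ev₂_tmul (η η' : Γ) (a a' : A) : F.ev₂ η η' (a ⊗ₜ a') = F.ev η a * F.ev η' a' := rfl

/-- The coefficient of `(η, η', η'')` in `L[Γ × Γ × Γ]` of an element of `A ⊗ (A ⊗ A)`. -/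
noncomputable def ev₃ (η η' η'' : Γ) : A ⊗[k] (A ⊗[k] A) →ₗ[k] L :=
  tensorEval (F.ev η) (F.ev₂ η' η'')

@[simp]
theorem ev₃_tmul (η η' η'' : Γ) (a : A) (t : A ⊗[k] A) :
    F.ev₃ η η' η'' (a ⊗ₜ t) = F.ev η a * F.ev₂ η' η'' t := rfl

/-- Inversion commutes with group automorphisms, so it preserves equivariance. -/
theorem exists_antipode (a : A) : ∃ a' : A, ∀ η, F.ev η a' = F.ev η⁻¹ a := by
  obtain ⟨a', ha'⟩ := (F.isEquivariant_iff fun η => F.ev η⁻¹ a).1 fun g η => by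
    change F.ev (F.act g η)⁻¹ a = _
    rw [← map_inv, ev_act]
  exact ⟨a', congrFun ha'⟩

theorem ev₃_assoc_tmul (η η' η'' : Γ) (t : A ⊗[k] A) (a : A) :
    F.ev₃ η η' η'' (TensorProduct.assoc k A A A (t ⊗ₜ a)) = F.ev₂ η η' t * F.ev η'' a := by
  induction t with
  | zero => simp
  | add x y hx hy => simp only [TensorProduct.add_tmul, map_add, hx, hy, add_mul]
  | tmul b b' => simp [mul_assoc]

theorem ev₂_mul (ζ ζ' : Γ) (t t' : A ⊗[k] A) :
    F.ev₂ ζ ζ' (t * t') = ∑ η, ∑ η', F.ev₂ η η' t * F.ev₂ (ζ * η⁻¹) (ζ' * η'⁻¹) t' := by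
  induction t with
  | zero => simp
  | add x y hx hy => simp only [add_mul, map_add, hx, hy, Finset.sum_add_distrib]
  | tmul a b =>
    induction t' with
    | zero => simp
    | add x y hx hy => simp only [mul_add, map_add, hx, hy, Finset.sum_add_distrib]
    | tmul a' b' =>
      rw [Algebra.TensorProduct.tmul_mul_tmul, ev₂_tmul, ev_mul, ev_mul, Finset.sum_mul_sum]
      exact Finset.sum_congr rfl fun η _ => Finset.sum_congr rfl fun η' _ => by
        simp only [ev₂_tmul]; ring

variable [FiniteDimensional k L] [IsGalois k L]

/-- A basis of `A` over `k` whose coefficient functions are a basis over `L`. -/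
noncomputable def basis : Module.Basis Γ k A :=
  (exists_basis_of_isEquivariant_iff F.coeff F.coeff_injective F.isEquivariant_iff).choose

theorem jointlyIndependent : JointlyIndependent F.basis F.ev := by
  obtain ⟨B, hB⟩ :=
    (exists_basis_of_isEquivariant_iff F.coeff F.coeff_injective F.isEquivariant_iff).choose_spec
  have h : (fun η => (fun η' => F.ev η' (F.basis η) : Γ → L)) = B := funext hB
  rw [JointlyIndependent, h]
  exact B.linearIndependent

theorem ext_ev₂ {t t' : A ⊗[k] A} (h : ∀ η η', F.ev₂ η η' t = F.ev₂ η η' t') : t = t' :=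
  (F.jointlyIndependent.tensor F.jointlyIndependent).eq_of_forall_eq fun p => h p.1 p.2

theorem ext_ev₃ {t t' : A ⊗[k] (A ⊗[k] A)}
    (h : ∀ η η' η'', F.ev₃ η η' η'' t = F.ev₃ η η' η'' t') : t = t' :=
  (F.jointlyIndependent.tensor
    (F.jointlyIndependent.tensor F.jointlyIndependent)).eq_of_forall_eq fun p => h p.1 p.2.1 p.2.2

/-- The function supported on the diagonal of `Γ × Γ` is equivariant, and products of basis elements
form an equivariant basis there; hence its coordinates lie in `k` and define an element of `A ⊗ A`.
-/
theorem exists_comul (a : A) :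
    ∃ t : A ⊗[k] A, ∀ η η', F.ev₂ η η' t = if η = η' then F.ev η a else 0 := by
  let ψ : Gal(L/k) →* Equiv.Perm (Γ × Γ) :=
    { toFun := fun g => Equiv.prodCongr (F.act g).toEquiv (F.act g).toEquiv
      map_one' := by ext <;> simp
      map_mul' := fun g h => by ext <;> simp }
  have hψ : ∀ g η η', ψ g (η, η') = (F.act g η, F.act g η') := fun _ _ _ => rfl
  have hli : LinearIndependent L fun p : Γ × Γ => (fun q : Γ × Γ =>
      F.ev₂ q.1 q.2 (F.basis.tensorProduct F.basis p) : Γ × Γ → L) :=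
    F.jointlyIndependent.tensor F.jointlyIndependent
  let B := basisOfLinearIndependentOfCardEqFinrank hli (by simp)
  have hBapp : ∀ p, B p = fun q : Γ × Γ => F.ev q.1 (F.basis p.1) * F.ev q.2 (F.basis p.2) := by
    intro p
    simp only [B, coe_basisOfLinearIndependentOfCardEqFinrank]
    funext q
    rw [Module.Basis.tensorProduct_apply', ev₂_tmul]
  have hB : ∀ p, IsEquivariant ψ (B p) := by
    rintro p g ⟨η, η'⟩
    rw [hψ, hBapp]
    simp only [ev_act, map_mul]
  have hc : IsEquivariant ψ (fun q : Γ × Γ => if q.1 = q.2 then F.ev q.1 a else 0) := by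
    rintro g ⟨η, η'⟩
    rw [hψ]
    by_cases h : η = η'
    · simp [h, ev_act]
    · simp [h]
  choose r hr using fun p => hc.repr_mem_range B hB p
  refine ⟨∑ p : Γ × Γ, r p • (F.basis p.1 ⊗ₜ F.basis p.2), fun η η' => ?_⟩
  have h1 := congrFun (B.sum_repr (fun q : Γ × Γ => if q.1 = q.2 then F.ev q.1 a else 0)) (η, η')
  simp only [← hr, hBapp] at h1
  rw [← h1, map_sum, Finset.sum_apply]
  refine Finset.sum_congr rfl fun p _ => ?_
  rw [map_smul, ev₂_tmul, Algebra.smul_def]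
  rfl

/-- The comultiplication, determined by `η ↦ η ⊗ η`. -/
noncomputable def comul : A →ₗ[k] A ⊗[k] A :=
  F.basis.constr k fun η => (F.exists_comul (F.basis η)).choose

theorem ev₂_comul (η η' : Γ) (a : A) :
    F.ev₂ η η' (F.comul a) = if η = η' then F.ev η a else 0 := by
  have h : F.ev₂ η η' ∘ₗ F.comul = if η = η' then F.ev η else 0 := by
    refine F.basis.ext fun ζ => ?_
    rw [LinearMap.comp_apply, comul, Module.Basis.constr_basis,
      (F.exists_comul (F.basis ζ)).choose_spec]
    split_ifs <;> rfl
  have h1 := LinearMap.congr_fun h a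
  rw [LinearMap.comp_apply] at h1
  rw [h1]
  split_ifs <;> rfl

/-- The Galois group permutes the coefficients, so their sum is invariant. -/
theorem exists_counit (a : A) : ∃ r : k, algebraMap k L r = ∑ η, F.ev η a := by
  refine (IsGalois.mem_range_algebraMap_iff_fixed _).2 fun g => ?_
  rw [map_sum]
  exact Fintype.sum_equiv (F.act g).toEquiv _ _ fun η => (F.ev_act g η a).symm

/-- The counit, determined by `η ↦ 1`. -/
noncomputable def counit : A →ₗ[k] k :=
  F.basis.constr k fun η => (F.exists_counit (F.basis η)).choose

theorem algebraMap_counit (a : A) : algebraMap k L (F.counit a) = ∑ η, F.ev η a := by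
  have h : Algebra.linearMap k L ∘ₗ F.counit = ∑ η, F.ev η := by
    refine F.basis.ext fun ζ => ?_
    rw [LinearMap.comp_apply, counit, Module.Basis.constr_basis, Algebra.linearMap_apply,
      (F.exists_counit (F.basis ζ)).choose_spec, LinearMap.sum_apply]
  have h1 := LinearMap.congr_fun h a
  rwa [LinearMap.sum_apply] at h1

/-- The antipode, determined by `η ↦ η⁻¹`. -/
noncomputable def antipode : A →ₗ[k] A :=
  F.basis.constr k fun η => (F.exists_antipode (F.basis η)).choose

theorem ev_antipode (η : Γ) (a : A) : F.ev η (F.antipode a) = F.ev η⁻¹ a := by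
  have h : F.ev η ∘ₗ F.antipode = F.ev η⁻¹ := by
    refine F.basis.ext fun ζ => ?_
    rw [LinearMap.comp_apply, antipode, Module.Basis.constr_basis,
      (F.exists_antipode (F.basis ζ)).choose_spec]
  exact LinearMap.congr_fun h a

theorem ev₃_lTensor_comul (η η' η'' : Γ) (t : A ⊗[k] A) :
    F.ev₃ η η' η'' (F.comul.lTensor A t) = if η' = η'' then F.ev₂ η η' t else 0 := by
  induction t with
  | zero => simp
  | add x y hx hy => simp only [map_add, hx, hy]; split_ifs <;> simp
  | tmul a a' => simp [ev₂_comul]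

theorem ev₃_assoc_rTensor_comul (η η' η'' : Γ) (t : A ⊗[k] A) :
    F.ev₃ η η' η'' (TensorProduct.assoc k A A A (F.comul.rTensor A t)) =
      if η = η' then F.ev₂ η η'' t else 0 := by
  induction t with
  | zero => simp
  | add x y hx hy => simp only [map_add, hx, hy]; split_ifs <;> simp
  | tmul a a' => simp [ev₃_assoc_tmul, ev₂_comul]

theorem ev_lid_rTensor_counit (η : Γ) (t : A ⊗[k] A) :
    F.ev η (TensorProduct.lid k A (F.counit.rTensor A t)) = ∑ η', F.ev₂ η' η t := by
  induction t with
  | zero => simp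
  | add x y hx hy => simp only [map_add, hx, hy, Finset.sum_add_distrib]
  | tmul a a' =>
    rw [LinearMap.rTensor_tmul, TensorProduct.lid_tmul, ev_smul, algebraMap_counit, Finset.sum_mul]
    rfl

theorem ev_rid_lTensor_counit (η : Γ) (t : A ⊗[k] A) :
    F.ev η (TensorProduct.rid k A (F.counit.lTensor A t)) = ∑ η', F.ev₂ η η' t := by
  induction t with
  | zero => simp
  | add x y hx hy => simp only [map_add, hx, hy, Finset.sum_add_distrib]
  | tmul a a' =>
    rw [LinearMap.lTensor_tmul, TensorProduct.rid_tmul, ev_smul, algebraMap_counit, mul_comm,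
      Finset.mul_sum]
    rfl

/-- The coalgebra structure of a form of a group algebra. -/
noncomputable abbrev coalgebra : Coalgebra k A where
  comul := F.comul
  counit := F.counit
  coassoc := by
    refine LinearMap.ext fun a => F.ext_ev₃ fun η η' η'' => ?_
    simp only [LinearMap.comp_apply, LinearEquiv.coe_coe, ev₃_assoc_rTensor_comul,
      ev₃_lTensor_comul, ev₂_comul]
    grind
  rTensor_counit_comp_comul := by
    refine LinearMap.ext fun a => (TensorProduct.lid k A).injective (F.ext_ev fun η => ?_)
    simp [ev_lid_rTensor_counit, ev₂_comul]
  lTensor_counit_comp_comul := by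
    refine LinearMap.ext fun a => (TensorProduct.rid k A).injective (F.ext_ev fun η => ?_)
    simp [ev_rid_lTensor_counit, ev₂_comul]

theorem counit_mul (a a' : A) : F.counit (a * a') = F.counit a * F.counit a' := by
  apply (algebraMap k L).injective
  rw [map_mul (algebraMap k L)]
  simp only [algebraMap_counit, ev_mul]
  rw [Finset.sum_comm, Finset.sum_mul]
  refine Finset.sum_congr rfl fun η _ => ?_
  rw [← Finset.mul_sum]
  congr 1
  exact Fintype.sum_equiv (Equiv.mulRight η⁻¹) _ _ fun ζ => rfl

theorem comul_mul (a a' : A) : F.comul (a * a') = F.comul a * F.comul a' := by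
  refine F.ext_ev₂ fun ζ ζ' => ?_
  rw [ev₂_mul]
  simp only [ev₂_comul, ite_mul, zero_mul, Finset.sum_ite_eq, Finset.mem_univ, if_true]
  by_cases h : ζ = ζ'
  · simp [h, ev_mul]
  · simp [h]

/-- The bialgebra structure of a form of a group algebra. -/
noncomputable abbrev bialgebra : Bialgebra k A :=
  letI := F.coalgebra
  Bialgebra.mk' k A
    ((algebraMap k L).injective (by
      change algebraMap k L (F.counit 1) = _
      simp [algebraMap_counit, ev_one]))
    (F.counit_mul _ _)
    (F.ext_ev₂ fun η η' => by
      change F.ev₂ η η' (F.comul 1) = F.ev₂ η η' (1 ⊗ₜ 1)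
      simp only [ev₂_comul, ev₂_tmul, ev_one]
      grind)
    (F.comul_mul _ _)

theorem ev_mul'_rTensor_antipode (ζ : Γ) (t : A ⊗[k] A) :
    F.ev ζ (LinearMap.mul' k A (F.antipode.rTensor A t)) = ∑ η, F.ev₂ η⁻¹ (ζ * η⁻¹) t := by
  induction t with
  | zero => simp
  | add x y hx hy => simp only [map_add, hx, hy, Finset.sum_add_distrib]
  | tmul a a' => simp [ev_mul, ev_antipode]

theorem ev_mul'_lTensor_antipode (ζ : Γ) (t : A ⊗[k] A) :
    F.ev ζ (LinearMap.mul' k A (F.antipode.lTensor A t)) = ∑ η, F.ev₂ η (η * ζ⁻¹) t := by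
  induction t with
  | zero => simp
  | add x y hx hy => simp only [map_add, hx, hy, Finset.sum_add_distrib]
  | tmul a a' => simp [ev_mul, ev_antipode]

/-- The Hopf algebra structure of a form of a group algebra. -/
noncomputable abbrev hopfAlgebra : HopfAlgebra k A :=
  { F.bialgebra with
    antipode := F.antipode
    mul_antipode_rTensor_comul := by
      refine LinearMap.ext fun a => F.ext_ev fun ζ => ?_
      change F.ev ζ (LinearMap.mul' k A (F.antipode.rTensor A (F.comul a))) =
        F.ev ζ (algebraMap k A (F.counit a))
      rw [ev_mul'_rTensor_antipode, ev_algebraMap, algebraMap_counit]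
      -- A term survives only on the diagonal `η⁻¹ = ζ * η⁻¹`, that is, for `ζ = 1`; the sum is then
      -- the counit.
      simp only [ev₂_comul]
      by_cases h : ζ = 1
      · simp only [h, one_mul, if_true]
        exact Fintype.sum_equiv (Equiv.inv Γ) _ _ fun _ => rfl
      · simp [h]
    mul_antipode_lTensor_comul := by
      refine LinearMap.ext fun a => F.ext_ev fun ζ => ?_
      change F.ev ζ (LinearMap.mul' k A (F.antipode.lTensor A (F.comul a))) =
        F.ev ζ (algebraMap k A (F.counit a))
      rw [ev_mul'_lTensor_antipode, ev_algebraMap, algebraMap_counit]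
      simp only [ev₂_comul]
      by_cases h : ζ = 1
      · simp [h]
      · simp [h] }

/-- The coefficients of `F.comul a` are supported on the diagonal, hence symmetric. -/
theorem isCocomm : letI := F.coalgebra; Coalgebra.IsCocomm k A := by
  let _ := F.coalgebra
  refine ⟨LinearMap.ext fun a => F.ext_ev₂ fun η η' => ?_⟩
  have h : ∀ t : A ⊗[k] A, F.ev₂ η η' (TensorProduct.comm k A A t) = F.ev₂ η' η t := by
    intro t
    induction t with
    | zero => simp
    | add x y hx hy => simp only [map_add, hx, hy]
    | tmul a b => simp [mul_comm]
  change F.ev₂ η η' (TensorProduct.comm k A A (F.comul a)) = F.ev₂ η η' (F.comul a)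
  rw [h, ev₂_comul, ev₂_comul]
  grind

end GroupAlgebraForm

end GroupAlgebraForm

/-! ### From a regular subgroup to a Hopf Galois structure. -/

section Backward

variable {k K L : Type*} [Field k] [Field K] [Field L] [Algebra k K] [Algebra k L]
  {N : Subgroup (Equiv.Perm (K →ₐ[k] L))} [Fintype N] [DecidableEq N]
  [FiniteDimensional k L] [IsGalois k L]

namespace IsRegularSubgroup

variable (hN : IsRegularSubgroup N)
  (hG : (galPerm k K L).range ≤ Subgroup.normalizer (N : Set (Equiv.Perm (K →ₐ[k] L))))
  (ρ : K →ₐ[k] L)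

/-- `twistedAlgebra N` as a form of the group algebra of `N`. -/
noncomputable def groupAlgebraForm : GroupAlgebraForm k L (twistedAlgebra N) N where
  act := galConj hG
  coeff := hN.coeff ρ
  coeff_injective := hN.coeff_injective ρ
  isEquivariant_iff c := by
    constructor
    · intro hc
      obtain ⟨T, hT⟩ := IsTwistedCombination.exists_end hG ρ hc
      exact ⟨⟨T, _, hT⟩, hN.coeff_eq ρ hT⟩
    · rintro ⟨T, rfl⟩
      exact (hN.isTwistedCombination_coeff ρ T).isEquivariant hG hN ρ
  coeff_one := hN.coeff_one ρ
  coeff_mul := hN.coeff_mul ρ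

theorem apply_twistedAlgebra (τ : K →ₐ[k] L) (T : twistedAlgebra N) (x : K) :
    τ ((T : Module.End k K) x) = ∑ η : N, (hN.groupAlgebraForm hG ρ).ev η T *
      (η : Equiv.Perm (K →ₐ[k] L)) τ x :=
  hN.isTwistedCombination_coeff ρ T τ x

theorem apply_mul'_map_twistedAlgebra (t : twistedAlgebra N ⊗[k] twistedAlgebra N) (x y : K) :
    ρ (LinearMap.mul' k K (TensorProduct.map
        (LinearMap.applyₗ x ∘ₗ (twistedAlgebra N).val.toLinearMap)
        (LinearMap.applyₗ y ∘ₗ (twistedAlgebra N).val.toLinearMap) t)) =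
      ∑ η : N, ∑ η' : N, (hN.groupAlgebraForm hG ρ).ev₂ η η' t *
        ((η : Equiv.Perm (K →ₐ[k] L)) ρ x * (η' : Equiv.Perm (K →ₐ[k] L)) ρ y) := by
  induction t with
  | zero => simp
  | add s t hs ht => simp only [map_add, hs, ht, add_mul, Finset.sum_add_distrib]
  | tmul T T' =>
    change ρ ((T : Module.End k K) x * (T' : Module.End k K) y) = _
    rw [map_mul, hN.apply_twistedAlgebra hG ρ, hN.apply_twistedAlgebra hG ρ, Finset.sum_mul_sum]
    refine Finset.sum_congr rfl fun η _ => Finset.sum_congr rfl fun η' _ => ?_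
    rw [GroupAlgebraForm.ev₂_tmul]
    ring

/-- The tautological Hopf action of `twistedAlgebra N` on `K`. -/
noncomputable def hopfAction :
    letI := (hN.groupAlgebraForm hG ρ).hopfAlgebra
    HopfAction k (twistedAlgebra N) K :=
  letI := (hN.groupAlgebraForm hG ρ).hopfAlgebra
  { μ := (twistedAlgebra N).val
    map_mul := by
      intro T x y
      apply ρ.injective
      refine Eq.trans ?_ (hN.apply_mul'_map_twistedAlgebra hG ρ
        ((hN.groupAlgebraForm hG ρ).comul T) x y).symm
      refine (hN.apply_twistedAlgebra hG ρ ρ T (x * y)).trans ?_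
      -- Only diagonal terms remain, and they match because each `η(ρ)` is multiplicative.
      simp [GroupAlgebraForm.ev₂_comul]
    map_one := by
      intro T
      apply ρ.injective
      refine (hN.apply_twistedAlgebra hG ρ ρ T 1).trans ?_
      change _ = ρ (algebraMap k K ((hN.groupAlgebraForm hG ρ).counit T))
      rw [AlgHom.commutes, GroupAlgebraForm.algebraMap_counit]
      simp }

-- Expand an element of the kernel in `F.basis` with coefficients in `K` and apply `ρ`: independence
-- of the embeddings `η(ρ)`, then of the coefficient functions of the basis, kills the coefficients.
include hN hG ρ in
theorem mul'_map_lmul_val_injective :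
    Function.Injective (LinearMap.mul' k (Module.End k K) ∘ₗ
      TensorProduct.map (Algebra.lmul k K).toLinearMap (twistedAlgebra N).val.toLinearMap) := by
  rw [injective_iff_map_eq_zero]
  intro t ht
  let F := hN.groupAlgebraForm hG ρ
  obtain ⟨s, rfl⟩ := TensorProduct.eq_repr_basis_right F.basis t
  have hs : s = 0 := by
    ext ζ
    apply ρ.injective
    rw [Finsupp.zero_apply, map_zero]
    refine Fintype.linearIndependent_iff.1 F.jointlyIndependent (fun ζ => ρ (s ζ)) ?_ ζ
    funext η
    rw [Finset.sum_apply]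
    refine hN.eq_zero_of_sum_eq_zero ρ (c := fun η => ∑ ζ, ρ (s ζ) * F.ev η (F.basis ζ))
      (fun x => ?_) η
    have h1 := congrArg ρ (LinearMap.congr_fun ht x)
    rw [Finsupp.sum_fintype _ _ (by simp), map_sum, LinearMap.sum_apply, map_sum] at h1
    rw [LinearMap.zero_apply, map_zero] at h1
    rw [← h1]
    simp only [Finset.sum_mul]
    rw [Finset.sum_comm]
    refine Finset.sum_congr rfl fun ζ _ => ?_
    change _ = ρ (s ζ * (F.basis ζ : Module.End k K) x)
    rw [map_mul, hN.apply_twistedAlgebra hG ρ, Finset.mul_sum]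
    exact Finset.sum_congr rfl fun η _ => mul_assoc _ _ _
  rw [hs, Finsupp.sum_zero_index]

end IsRegularSubgroup

end Backward

theorem IsRegularSubgroup.isHopfGalois {k K L : Type*} [Field k] [Field K] [Field L] [Algebra k K]
    [Algebra k L] [FiniteDimensional k K] [Algebra.IsSeparable k K] [IsNormalClosure k K L]
    {N : Subgroup (Equiv.Perm (K →ₐ[k] L))} (hN : IsRegularSubgroup N)
    (hG : (galPerm k K L).range ≤ Subgroup.normalizer (N : Set (Equiv.Perm (K →ₐ[k] L)))) :
    IsHopfGalois k K := by
  classical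
  have := IsNormalClosure.finiteDimensional k K L
  have := IsNormalClosure.isGalois k K L
  have := Fintype.ofFinite N
  have hcard : Nat.card (K →ₐ[k] L) = Module.finrank k K := card_algHom_eq_finrank
  have : Nonempty (K →ₐ[k] L) := (Nat.card_pos_iff.1 (hcard ▸ Module.finrank_pos)).1
  obtain ⟨ρ⟩ := this
  let F := hN.groupAlgebraForm hG ρ
  have := Module.Free.of_basis F.basis
  have := Module.Finite.of_basis F.basis
  have hrank : Module.finrank k (twistedAlgebra N) = Module.finrank k K := by
    rw [Module.finrank_eq_card_basis F.basis, ← hcard, ← Nat.card_eq_fintype_card]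
    exact Nat.card_congr (hN.equiv ρ)
  have hinj := hN.mul'_map_lmul_val_injective hG ρ
  have hbij : Function.Bijective (LinearMap.mul' k (Module.End k K) ∘ₗ
      TensorProduct.map (Algebra.lmul k K).toLinearMap (twistedAlgebra N).val.toLinearMap) := by
    -- Both sides have dimension `n²` over `k`, since `N` has as many elements as there are
    -- embeddings.
    refine ⟨hinj, (LinearMap.injective_iff_surjective_of_finrank_eq_finrank ?_).1 hinj⟩
    rw [Module.finrank_tensorProduct, Module.finrank_linearMap, hrank]
  exact ⟨twistedAlgebra N, inferInstance, F.hopfAlgebra, Module.Finite.of_basis F.basis,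
    F.isCocomm, hN.hopfAction hG ρ, hbij⟩

/-- The Greither–Pareigis theorem: `K/k` is Hopf Galois if and only if the group of permutations of
the embeddings of `K` into its Galois closure has a regular subgroup normalized by the Galois
group. -/
theorem isHopfGalois_iff_exists_isRegularSubgroup {k K L : Type*} [Field k] [Field K] [Field L]
    [Algebra k K] [Algebra k L] [FiniteDimensional k K] [Algebra.IsSeparable k K]
    [IsNormalClosure k K L] :
    IsHopfGalois k K ↔ ∃ N : Subgroup (Equiv.Perm (K →ₐ[k] L)), IsRegularSubgroup N ∧
      (galPerm k K L).range ≤ Subgroup.normalizer (N : Set (Equiv.Perm (K →ₐ[k] L))) :=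
  ⟨fun h => h.exists_isRegularSubgroup L, fun ⟨_, hN, hG⟩ => hN.isHopfGalois hG⟩

/-! ### Transport to `S_n` and the proposition. -/

section Transport

variable {G S T : Type*} [Group G]

theorem isPretransitive_range_permCongr (φ : G →* Equiv.Perm S) (h : ∀ s t, ∃ g, φ g s = t)
    (e : S ≃ T) : MulAction.IsPretransitive (φ.range.map e.permCongrHom.toMonoidHom) T := by
  refine ⟨fun x y => ?_⟩
  obtain ⟨g, hg⟩ := h (e.symm x) (e.symm y)
  refine ⟨⟨_, φ g, ⟨g, rfl⟩, rfl⟩, ?_⟩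
  change e (φ g (e.symm x)) = y
  rw [hg, Equiv.apply_symm_apply]

theorem nonempty_mulEquiv_range_permCongr (φ : G →* Equiv.Perm S) (h : Function.Injective φ)
    (e : S ≃ T) : Nonempty (φ.range.map e.permCongrHom.toMonoidHom ≃* G) :=
  ⟨((φ.ofInjective h).trans (φ.range.equivMapOfInjective _ e.permCongrHom.injective)).symm⟩

end Transport

/-- Let `K/k` be a separable extension of degree `n` with Galois closure `L/k` and `G = Gal(L/k)`,
and assume that all transitive subgroups of `S_n` isomorphic to `G` are conjugate in `S_n`.  Then
`K/k` is Hopf Galois if and only if there is a regular subgroup `N` of `S_n` such that `Hol(N)` has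
a transitive subgroup isomorphic to `G`. -/
theorem mainTheorem1 {k K L : Type*} [Field k] [Field K] [Field L] [Algebra k K] [Algebra k L]
    [Algebra K L] [IsScalarTower k K L] [FiniteDimensional k K] [Algebra.IsSeparable k K]
    [IsNormalClosure k K L] (n : ℕ) (hn : Module.finrank k K = n)
    (hconj : ∀ G₁ G₂ : Subgroup (Equiv.Perm (Fin n)),
      MulAction.IsPretransitive G₁ (Fin n) → MulAction.IsPretransitive G₂ (Fin n) →
      Nonempty (G₁ ≃* Gal(L/k)) → Nonempty (G₂ ≃* Gal(L/k)) →
      ∃ σ : Equiv.Perm (Fin n), G₂ = G₁.map (MulAut.conj σ).toMonoidHom) :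
    IsHopfGalois k K ↔
      ∃ (N : Subgroup (Equiv.Perm (Fin n))) (hN : IsRegularSubgroup N) (i : Fin n)
        (G₁ : Subgroup (Equiv.Perm (Fin n))),
        G₁ ≤ hN.hol i ∧ MulAction.IsPretransitive G₁ (Fin n) ∧ Nonempty (G₁ ≃* Gal(L/k)) := by
  have := IsNormalClosure.normal (F := k) (K := K) (L := L)
  have hcard : Nat.card (K →ₐ[k] L) = n := card_algHom_eq_finrank.trans hn
  let e : (K →ₐ[k] L) ≃ Fin n := Finite.equivFinOfCardEq hcard
  have htrans := fun e : (K →ₐ[k] L) ≃ Fin n =>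
    isPretransitive_range_permCongr (galPerm k K L) exists_galPerm_apply_eq e
  have hiso := fun e : (K →ₐ[k] L) ≃ Fin n =>
    nonempty_mulEquiv_range_permCongr (galPerm k K L) galPerm_injective e
  rw [isHopfGalois_iff_exists_isRegularSubgroup (L := L)]
  constructor
  · rintro ⟨N, hN, hG⟩
    refine ⟨_, hN.map_permCongrHom e, e (IsScalarTower.toAlgHom k K L), _, ?_, htrans e, hiso e⟩
    rw [IsRegularSubgroup.hol_eq_normalizer, ← Subgroup.map_normalizer_permCongrHom]
    exact Subgroup.map_mono hG
  · rintro ⟨N, hN, i, G₁, hG₁, hG₁trans, hG₁iso⟩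
    -- Relabelling by `σ` makes the given subgroup `G₁` the image of the Galois action itself, so
    -- `N` can be pulled back to a regular subgroup normalized by it.
    obtain ⟨σ, hσ⟩ := hconj _ G₁ (htrans e) hG₁trans (hiso e) hG₁iso
    let e' : (K →ₐ[k] L) ≃ Fin n := e.trans σ
    have he' : G₁ = (galPerm k K L).range.map e'.permCongrHom.toMonoidHom := by
      rw [hσ, Subgroup.map_map]
      rfl
    rw [hN.hol_eq_normalizer, he'] at hG₁
    refine ⟨_, hN.map_permCongrHom e'.symm, ?_⟩
    rw [← Subgroup.map_normalizer_permCongrHom]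
    refine le_trans ?_ (Subgroup.map_mono hG₁)
    rw [Subgroup.map_map]
    exact fun g hg => ⟨g, hg, by ext x; simp [Equiv.permCongrHom]⟩
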